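/- Let $A=(a_{ij})\in\mathbb R^{N\times N}$ be a Metzler matrix ($a_{ij}\ge 0$ for $i\ne j$) with $\mathbf 1^{T}A=0$, and consider the initial value problem $y'=Ay$, $y(0)=y^0>0$ (inequalities between vectors are componentwise). It is a positive and conservative production-destruction system with $p_{ij}(y)=d_{ji}(y)=a_{ij}y_j$ for $i\neq j$ and $p_{ii}=d_{ii}=0$. A linear invariant is a map $y\mapsto n^{T}y$ with $n\in\ker A^{T}$; a steady state of the initial value problem is a vector $y^*\in\ker A$ with $n^{T}y^*=n^{T}y^0$ for all $n\in\ker A^{T}$. Let $0\le\alpha\le 1$, $\beta>0$, $\alpha\beta+\frac1{2\beta}\le 1$, and put $\beta_{20}=1-\frac1{2\beta}-\alpha\beta$, $\beta_{21}=\frac1{2\beta}$, $s=\frac{1-\alpha\beta+\alpha\beta^2}{\beta(1-\alpha\beta)}$. For a step size $\Delta t>0$, the iterates $u^0,u^1,\dots$ of SSPMPRK2$(\alpha,\beta)$ with starting value $u^0=x>0$ are given by the equations $$u_i^{(1)}=u_i^n+\beta\Delta t\Bigl(\sum_j p_{ij}(u^n)\frac{u_j^{(1)}}{u_j^n}-\sum_j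 d_{ij}(u^n)\frac{u_i^{(1)}}{u_i^n}\Bigr),$$ $$u_i^{n+1}=(1-\alpha)u_i^n+\alpha u_i^{(1)}+\Delta t\Bigl(\sum_j\bigl(\beta_{20}p_{ij}(u^n)+\beta_{21}p_{ij}(u^{(1)})\bigr)\frac{u_j^{n+1}}{(u_j^n)^{1-s}(u_j^{(1)})^{s}}-\sum_j\bigl(\beta_{20}d_{ij}(u^n)+\beta_{21}d_{ij}(u^{(1)})\bigr)\frac{u_i^{n+1}}{(u_i^n)^{1-s}(u_i^{(1)})^{s}}\Bigr).$$ Suppose that the initial value problem has a positive steady state $y^*$, and that one of the following conditions holds: 1. $\alpha<\frac1{2\beta}$ and $(\alpha,\beta)\ne(0,\frac12)$; 2. $\alpha=\frac1{2\beta}$ or $(\alpha,\beta)=(0,\frac12)$, and in addition all nonzero (complex) eigenvalues of $A$ have negative real part. Then $y^*$ is the unique steady state of the initial value problem, and the iterates of SSPMPRK2$(\alpha,\beta)$ converge locally to $y^*$ for every $\Delta t>0$: for every $\Delta t>0$ there is a $\delta>0$ such that, for every starting value $x>0$ with $n^{T}x=n^{T}y^*$ for all $n\in\ker A^{T}$ and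 $\|x-y^*\|<\delta$, the iterates exist, are uniquely determined and positive, and converge to $y^*$. -/

import Mathlib

open Filter Topology Matrix

/-- The vector `y` is (componentwise) positive. -/
def IsPositiveVec {N : ℕ} (y : Fin N → ℝ) : Prop := ∀ i, 0 < y i

/-- A Metzler matrix: all off-diagonal entries are nonnegative. -/
def IsMetzler {N : ℕ} (A : Matrix (Fin N) (Fin N) ℝ) : Prop :=
  ∀ i j, i ≠ j → 0 ≤ A i j

/-- `n` defines a linear invariant `y ↦ nᵀ y` of `y' = A y`, i.e. `n ∈ ker Aᵀ`. -/
def IsLinearInvariant {N : ℕ} (A : Matrix (Fin N) (Fin N) ℝ) (n : Fin N → ℝ) : Prop :=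
  Aᵀ *ᵥ n = 0

/-- The system `y' = A y` is conservative: the vector of ones lies in `ker Aᵀ`. -/
def IsConservative {N : ℕ} (A : Matrix (Fin N) (Fin N) ℝ) : Prop :=
  IsLinearInvariant A (fun _ => 1)

/-- `x` and `y` share all linear invariants of `y' = A y`. -/
def SameInvariants {N : ℕ} (A : Matrix (Fin N) (Fin N) ℝ) (x y : Fin N → ℝ) : Prop :=
  ∀ n : Fin N → ℝ, IsLinearInvariant A n → n ⬝ᵥ x = n ⬝ᵥ y

/-- `y` is a steady state of the initial value problem `y' = A y`, `y(0) = y₀`: it is an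
equilibrium, and it carries the values of the linear invariants prescribed by `y₀`. -/
def IsSteadyStateOfIVP {N : ℕ} (A : Matrix (Fin N) (Fin N) ℝ) (y₀ y : Fin N → ℝ) : Prop :=
  A *ᵥ y = 0 ∧ SameInvariants A y y₀

/-- Production terms of `y' = A y`: `p i j (y) = a i j * y j` for `i ≠ j`, and `p i i = 0`. -/
def linProd {N : ℕ} (A : Matrix (Fin N) (Fin N) ℝ) (y : Fin N → ℝ) (i j : Fin N) : ℝ :=
  if i = j then 0 else A i j * y j

/-- Destruction terms of `y' = A y`: `d i j = p j i`. -/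
def linDest {N : ℕ} (A : Matrix (Fin N) (Fin N) ℝ) (y : Fin N → ℝ) (i j : Fin N) : ℝ :=
  linProd A y j i

/-- The admissible parameters of the second order scheme. -/
def SSPMPRK2Admissible (α β : ℝ) : Prop :=
  0 ≤ α ∧ α ≤ 1 ∧ 0 < β ∧ α * β + 1 / (2 * β) ≤ 1

/-- The coefficient `β₂₀`. -/
noncomputable def sspBeta20 (α β : ℝ) : ℝ := 1 - 1 / (2 * β) - α * β

/-- The coefficient `β₂₁`. -/
noncomputable def sspBeta21 (β : ℝ) : ℝ := 1 / (2 * β)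

/-- The exponent `s`. -/
noncomputable def sspExponent (α β : ℝ) : ℝ :=
  (1 - α * β + α * β ^ 2) / (β * (1 - α * β))

/-- First stage of SSPMPRK2(α,β) with step size `dt`, for a production-destruction system with
production terms `p` and destruction terms `d`: `y₁` is the stage value belonging to `y`. -/
def SSPMPRK2Stage {N : ℕ} (p d : (Fin N → ℝ) → Fin N → Fin N → ℝ) (β dt : ℝ)
    (y y₁ : Fin N → ℝ) : Prop :=
  ∀ i, y₁ i = y i + β * dt *
    ((∑ j, p y i j * (y₁ j / y j)) - ∑ j, d y i j * (y₁ i / y i))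

/-- Final stage of SSPMPRK2(α,β): `z` is the new approximation belonging to the old approximation
`y` and the stage value `y₁`. -/
def SSPMPRK2Final {N : ℕ} (p d : (Fin N → ℝ) → Fin N → Fin N → ℝ) (α β dt : ℝ)
    (y y₁ z : Fin N → ℝ) : Prop :=
  ∀ i, z i = (1 - α) * y i + α * y₁ i + dt *
    ((∑ j, (sspBeta20 α β * p y i j + sspBeta21 β * p y₁ i j) *
        (z j / (y j ^ (1 - sspExponent α β) * y₁ j ^ sspExponent α β)))
      - ∑ j, (sspBeta20 α β * d y i j + sspBeta21 β * d y₁ i j) *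
        (z i / (y i ^ (1 - sspExponent α β) * y₁ i ^ sspExponent α β)))

/-- One step `y ↦ z` of SSPMPRK2(α,β). -/
def SSPMPRK2Step {N : ℕ} (p d : (Fin N → ℝ) → Fin N → Fin N → ℝ) (α β dt : ℝ)
    (y z : Fin N → ℝ) : Prop :=
  ∃ y₁ : Fin N → ℝ, SSPMPRK2Stage p d β dt y y₁ ∧ SSPMPRK2Final p d α β dt y y₁ z

/-- `u 0, u 1, u 2, …` are iterates of SSPMPRK2(α,β) with step size `dt`, applied to `y' = A y`,
with starting value `x`. -/
def IsSSPMPRK2Iterates {N : ℕ} (A : Matrix (Fin N) (Fin N) ℝ) (α β dt : ℝ)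
    (x : Fin N → ℝ) (u : ℕ → Fin N → ℝ) : Prop :=
  u 0 = x ∧ ∀ n, SSPMPRK2Step (linProd A) (linDest A) α β dt (u n) (u (n + 1))

/-- All nonzero (complex) eigenvalues of the real matrix `A` have negative real part. -/
def NonzeroEigenvaluesNegRe {N : ℕ} (A : Matrix (Fin N) (Fin N) ℝ) : Prop :=
  ∀ μ : ℂ, μ ∈ spectrum ℂ (A.map Complex.ofReal) → μ ≠ 0 → μ.re < 0

/-! Put `Z = dt • A` and `c = 1 - α * β`. At positive arguments both stages are linear systems with
matrices `1 - B`, where `B` is a generator. Such a matrix is invertible with a positivity preserving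
inverse, so a step is a well-defined map `stepVec` that keeps positivity and all linear invariants.
At a positive equilibrium `y` its derivative `linStep` is the rational function `(1 - (c + β - 1) z
- q z²) / ((1 - c z) (1 - β z))` of `Z`, with `q = c + β - 1/2 - c β`. Instead of locating its
eigenvalues, one measures it in the energy `∑ h i ^ 2 / y i`. There `Z` is dissipative: `⟨u, Z u⟩`
is minus a Dirichlet form (`IsGenerator.sum_mul_mulVec_div`). The loss of energy under the
derivative is a sum of dissipations and a square, with nonnegative coefficients when `c ≥ 1/2` and
`β ≥ 1/2` (`IsGenerator.sum_sq_div_lt`). Admissibility gives the second inequality, and `α ≤ 1 / (2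
* β)` gives the first. The loss is strict on increments on which all invariants vanish, because
these meet `ker Z` only in zero (`IsGenerator.eq_zero_of_mulVec_eq_zero`); this also yields
uniqueness of the steady state. Compactness of the sphere makes the loss uniform, differentiability
carries it to the nonlinear step, and the energy then decays geometrically. -/

/-- Generators: Metzler matrices whose columns sum to zero. -/
structure IsGenerator {N : ℕ} (B : Matrix (Fin N) (Fin N) ℝ) : Prop where
  metzler : IsMetzler B
  col_sum : ∀ j, ∑ i, B i j = 0

/-! ### Generators and positivity of the resolvent -/

namespace IsGenerator

variable {N : ℕ} {B : Matrix (Fin N) (Fin N) ℝ}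

theorem of_isConservative (hM : IsMetzler B) (hc : IsConservative B) : IsGenerator B := by
  refine ⟨hM, fun j => ?_⟩
  have := congrFun hc j
  simpa [Matrix.mulVec, dotProduct] using this

theorem smul (hB : IsGenerator B) {t : ℝ} (ht : 0 ≤ t) : IsGenerator (t • B) := by
  refine ⟨fun i j hij => mul_nonneg ht (hB.metzler i j hij), fun j => ?_⟩
  simp [← Finset.mul_sum, hB.col_sum j]

theorem mul_diagonal (hB : IsGenerator B) {w : Fin N → ℝ} (hw : ∀ i, 0 ≤ w i) :
    IsGenerator (B * diagonal w) := by
  refine ⟨fun i j hij => ?_, fun j => ?_⟩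
  · rw [Matrix.mul_diagonal]
    exact mul_nonneg (hB.metzler i j hij) (hw j)
  · simp [Matrix.mul_diagonal, ← Finset.sum_mul, hB.col_sum j]

theorem diag_nonpos (hB : IsGenerator B) (i : Fin N) : B i i ≤ 0 := by
  have h := hB.col_sum i
  rw [← Finset.add_sum_erase _ _ (Finset.mem_univ i)] at h
  have : 0 ≤ ∑ j ∈ Finset.univ.erase i, B j i :=
    Finset.sum_nonneg fun j hj => hB.metzler j i (Finset.ne_of_mem_erase hj)
  linarith

/-- The negative part `n` of `x` satisfies `n ≤ B *ᵥ n` componentwise. Summing over components kills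
the right side, since columns sum to zero, so `n = 0`. -/
theorem nonneg_of_sub_mulVec_nonneg (hB : IsGenerator B) {x : Fin N → ℝ}
    (hx : ∀ i, 0 ≤ x i - (B *ᵥ x) i) (i : Fin N) : 0 ≤ x i := by
  have key : ∀ i, max (-x i) 0 ≤ ∑ j, B i j * max (-x j) 0 := by
    intro i
    have hi := hx i
    simp only [Matrix.mulVec, dotProduct] at hi
    rw [← Finset.add_sum_erase _ _ (Finset.mem_univ i)] at hi ⊢
    have hoff : -∑ j ∈ Finset.univ.erase i, B i j * max (-x j) 0
        ≤ ∑ j ∈ Finset.univ.erase i, B i j * x j := by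
      rw [← Finset.sum_neg_distrib]
      refine Finset.sum_le_sum fun j hj => ?_
      have h1 := hB.metzler i j (Finset.ne_of_mem_erase hj).symm
      nlinarith [le_max_left (-x j) 0]
    have hpos : 0 ≤ ∑ j ∈ Finset.univ.erase i, B i j * max (-x j) 0 :=
      Finset.sum_nonneg fun j hj =>
        mul_nonneg (hB.metzler i j (Finset.ne_of_mem_erase hj).symm) (le_max_right _ _)
    rcases le_total 0 (x i) with h | h
    · rw [max_eq_right (by linarith)]
      linarith
    · rw [max_eq_left (by linarith)]
      linarith
  have hsum : ∑ i, max (-x i) 0 ≤ 0 := by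
    calc ∑ i, max (-x i) 0 ≤ ∑ i, ∑ j, B i j * max (-x j) 0 :=
          Finset.sum_le_sum fun i _ => key i
      _ = 0 := by
          rw [Finset.sum_comm]
          simp [← Finset.sum_mul, hB.col_sum]
  have h0 := Finset.single_le_sum (f := fun i => max (-x i) 0)
    (fun j _ => le_max_right _ _) (Finset.mem_univ i)
  have := le_max_left (-x i) 0
  linarith

theorem pos_of_sub_mulVec_pos (hB : IsGenerator B) {x : Fin N → ℝ}
    (hx : ∀ i, 0 < x i - (B *ᵥ x) i) (i : Fin N) : 0 < x i := by
  have h0 := hB.nonneg_of_sub_mulVec_nonneg fun i => (hx i).le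
  have hi := hx i
  simp only [Matrix.mulVec, dotProduct] at hi
  rw [← Finset.add_sum_erase _ _ (Finset.mem_univ i)] at hi
  have hpos : 0 ≤ ∑ j ∈ Finset.univ.erase i, B i j * x j :=
    Finset.sum_nonneg fun j hj =>
      mul_nonneg (hB.metzler i j (Finset.ne_of_mem_erase hj).symm) (h0 j)
  have := hB.diag_nonpos i
  rcases (h0 i).lt_or_eq with h | h
  · exact h
  · rw [← h] at hi
    linarith

theorem isUnit_det_one_sub (hB : IsGenerator B) : IsUnit (1 - B).det := by
  rw [isUnit_iff_ne_zero]
  intro hdet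
  obtain ⟨v, hv, h⟩ := Matrix.exists_mulVec_eq_zero_iff.mpr hdet
  rw [sub_mulVec, one_mulVec, sub_eq_zero] at h
  refine hv (funext fun i => le_antisymm ?_ ?_)
  · have := hB.nonneg_of_sub_mulVec_nonneg (x := -v)
      (fun i => by rw [mulVec_neg, ← h]; simp) i
    simpa using this
  · exact hB.nonneg_of_sub_mulVec_nonneg (fun i => by rw [← h]; simp) i

theorem eq_inv_mulVec_iff (hB : IsGenerator B) {x b : Fin N → ℝ} :
    x = (1 - B)⁻¹ *ᵥ b ↔ x - B *ᵥ x = b := by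
  have hu := hB.isUnit_det_one_sub
  constructor
  · rintro rfl
    have : (1 - B) *ᵥ ((1 - B)⁻¹ *ᵥ b) = b := by
      rw [mulVec_mulVec, Matrix.mul_nonsing_inv _ hu, one_mulVec]
    rwa [sub_mulVec, one_mulVec] at this
  · rintro rfl
    have : x - B *ᵥ x = (1 - B) *ᵥ x := by rw [sub_mulVec, one_mulVec]
    rw [this, mulVec_mulVec, Matrix.nonsing_inv_mul _ hu, one_mulVec]

theorem inv_mulVec_sub (hB : IsGenerator B) (b : Fin N → ℝ) :
    (1 - B)⁻¹ *ᵥ b - B *ᵥ ((1 - B)⁻¹ *ᵥ b) = b :=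
  hB.eq_inv_mulVec_iff.mp rfl

theorem inv_mulVec_pos (hB : IsGenerator B) {b : Fin N → ℝ} (hb : IsPositiveVec b) :
    IsPositiveVec ((1 - B)⁻¹ *ᵥ b) := by
  refine hB.pos_of_sub_mulVec_pos fun i => ?_
  have := congrFun (hB.inv_mulVec_sub b) i
  rw [Pi.sub_apply] at this
  rw [this]
  exact hb i

end IsGenerator

/-! ### Dissipativity in the energy weighted by a positive equilibrium -/

section Dissipative

variable {N : ℕ} {B : Matrix (Fin N) (Fin N) ℝ} {y : Fin N → ℝ}

/-- Expanding the square, one pure term vanishes by `B *ᵥ y = 0` (rows) and the other by the zero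
column sums; only the cross term remains. No symmetry of `B` is needed. -/
theorem IsGenerator.sum_mul_mulVec_div (hB : IsGenerator B) (hy : IsPositiveVec y)
    (hBy : B *ᵥ y = 0) (u : Fin N → ℝ) :
    -2 * ∑ i, u i * (B *ᵥ u) i / y i
      = ∑ i, ∑ j, B i j * y j * (u i / y i - u j / y j) ^ 2 := by
  have e1 : ∑ i, ∑ j, B i j * y j * (u i / y i) ^ 2 = 0 := by
    refine Finset.sum_eq_zero fun i _ => ?_
    rw [← Finset.sum_mul]
    have := congrFun hBy i
    simp only [Matrix.mulVec, dotProduct, Pi.zero_apply] at this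
    rw [this, zero_mul]
  have e2 : ∑ i, ∑ j, B i j * y j * (u j / y j) ^ 2 = 0 := by
    rw [Finset.sum_comm]
    refine Finset.sum_eq_zero fun j _ => ?_
    simp only [mul_assoc]
    rw [← Finset.sum_mul, hB.col_sum, zero_mul]
  have e3 : ∑ i, u i * (B *ᵥ u) i / y i
      = ∑ i, ∑ j, B i j * y j * (u i / y i) * (u j / y j) := by
    refine Finset.sum_congr rfl fun i _ => ?_
    simp only [Matrix.mulVec, dotProduct]
    rw [Finset.mul_sum, Finset.sum_div]
    refine Finset.sum_congr rfl fun j _ => ?_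
    have := (hy i).ne'
    have := (hy j).ne'
    field_simp
  have e4 : ∑ i, ∑ j, B i j * y j * (u i / y i - u j / y j) ^ 2
      = ∑ i, ∑ j, B i j * y j * (u i / y i) ^ 2 + ∑ i, ∑ j, B i j * y j * (u j / y j) ^ 2
        + -2 * ∑ i, ∑ j, B i j * y j * (u i / y i) * (u j / y j) := by
    simp only [Finset.mul_sum, ← Finset.sum_add_distrib]
    refine Finset.sum_congr rfl fun i _ => Finset.sum_congr rfl fun j _ => ?_
    ring
  rw [e4, e1, e2, e3]
  ring

theorem IsGenerator.edge_term_nonneg (hB : IsGenerator B) (hy : IsPositiveVec y)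
    (u : Fin N → ℝ) (i j : Fin N) : 0 ≤ B i j * y j * (u i / y i - u j / y j) ^ 2 := by
  rcases eq_or_ne i j with rfl | h
  · simp
  · exact mul_nonneg (mul_nonneg (hB.metzler i j h) (hy j).le) (sq_nonneg _)

theorem IsGenerator.dissipative (hB : IsGenerator B) (hy : IsPositiveVec y)
    (hBy : B *ᵥ y = 0) (u : Fin N → ℝ) : ∑ i, u i * (B *ᵥ u) i / y i ≤ 0 := by
  have h := hB.sum_mul_mulVec_div hy hBy u
  have : 0 ≤ ∑ i, ∑ j, B i j * y j * (u i / y i - u j / y j) ^ 2 :=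
    Finset.sum_nonneg fun i _ => Finset.sum_nonneg fun j _ => hB.edge_term_nonneg hy u i j
  linarith

theorem IsGenerator.edge_eq (hB : IsGenerator B) (hy : IsPositiveVec y) (hBy : B *ᵥ y = 0)
    {u : Fin N → ℝ} (hu : ∑ i, u i * (B *ᵥ u) i / y i = 0) (i j : Fin N) :
    B i j * (u i / y i) = B i j * (u j / y j) := by
  have h := hB.sum_mul_mulVec_div hy hBy u
  rw [hu, mul_zero, eq_comm, Finset.sum_eq_zero_iff_of_nonneg
    (fun i _ => Finset.sum_nonneg fun j _ => hB.edge_term_nonneg hy u i j)] at h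
  have h := h i (Finset.mem_univ i)
  rw [Finset.sum_eq_zero_iff_of_nonneg (fun j _ => hB.edge_term_nonneg hy u i j)] at h
  have h := h j (Finset.mem_univ j)
  rcases mul_eq_zero.mp h with h | h
  · rcases mul_eq_zero.mp h with h | h
    · rw [h, zero_mul, zero_mul]
    · exact absurd h (hy j).ne'
  · rw [sub_eq_zero.mp (pow_eq_zero_iff two_ne_zero |>.mp h)]

theorem IsGenerator.mulVec_eq_zero_of_dissipation_eq_zero (hB : IsGenerator B)
    (hy : IsPositiveVec y) (hBy : B *ᵥ y = 0)
    {u : Fin N → ℝ} (hu : ∑ i, u i * (B *ᵥ u) i / y i = 0) : B *ᵥ u = 0 := by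
  funext i
  have h0 := congrFun hBy i
  simp only [Matrix.mulVec, dotProduct, Pi.zero_apply] at h0 ⊢
  have : ∑ j, B i j * u j = (∑ j, B i j * y j) * (u i / y i) := by
    rw [Finset.sum_mul]
    refine Finset.sum_congr rfl fun j _ => ?_
    have h1 := hB.edge_eq hy hBy hu i j
    have h2 : B i j * y j * (u i / y i) = B i j * (u i / y i) * y j := by ring
    rw [h2, h1, mul_assoc, div_mul_cancel₀ _ (hy j).ne']
  rw [this, h0, zero_mul]

/-- Vanishing dissipation makes `h / y` constant along the edges of `B`, hence itself a linear
invariant. Pairing it with `h` gives `∑ h i ^ 2 / y i = 0`. -/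
theorem IsGenerator.eq_zero_of_mulVec_eq_zero (hB : IsGenerator B)
    (hy : IsPositiveVec y) (hBy : B *ᵥ y = 0) {h : Fin N → ℝ} (hh : B *ᵥ h = 0)
    (hinv : ∀ n, IsLinearInvariant B n → n ⬝ᵥ h = 0) : h = 0 := by
  have hn : IsLinearInvariant B (fun i => h i / y i) := by
    funext j
    simp only [Matrix.mulVec, dotProduct, Pi.zero_apply, transpose_apply]
    have : ∑ i, B i j * (h i / y i) = ∑ i, B i j * (h j / y j) :=
      Finset.sum_congr rfl fun i _ => hB.edge_eq hy hBy (by simp [hh]) i j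
    rw [this, ← Finset.sum_mul, hB.col_sum, zero_mul]
  have h0 := hinv _ hn
  rw [dotProduct, Finset.sum_eq_zero_iff_of_nonneg] at h0
  · funext i
    have := h0 i (Finset.mem_univ i)
    have hy' := (hy i).ne'
    have : h i * h i = 0 := by
      field_simp at this
      nlinarith
    simpa using this
  · intro i _
    rw [div_mul_eq_mul_div]
    exact div_nonneg (mul_self_nonneg _) (hy i).le

end Dissipative

/-! ### Energy contraction of the linearised step -/

section Contraction

variable {N : ℕ} {Z : Matrix (Fin N) (Fin N) ℝ} {y : Fin N → ℝ}

/-- Energy estimate for the rational function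
`(1 - (c + β - 1) z - q z²) / ((1 - c z) (1 - β z))`, `q = c + β - 1/2 - c β`, of a generator. -/
theorem IsGenerator.sum_sq_div_lt (hZ : IsGenerator Z) (hy : IsPositiveVec y) (hZy : Z *ᵥ y = 0)
    {c β : ℝ} (hc : 1 / 2 ≤ c) (hβ : 1 / 2 ≤ β) {v v₁ v₂ h l : Fin N → ℝ}
    (hv₁ : v₁ = Z *ᵥ v) (hv₂ : v₂ = Z *ᵥ v₁)
    (hh : h = v - (c + β) • v₁ + (c * β) • v₂)
    (hl : l = v - (c + β - 1) • v₁ - (c + β - 1 / 2 - c * β) • v₂)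
    (hinv : ∀ n, IsLinearInvariant Z n → n ⬝ᵥ h = 0) (hne : h ≠ 0) :
    ∑ i, l i ^ 2 / y i < ∑ i, h i ^ 2 / y i := by
  set e : ℝ := c + β - 1 / 2 with he
  have hZve : Z *ᵥ (v - e • v₁) = v₁ - e • v₂ := by
    rw [mulVec_sub, mulVec_smul, ← hv₁, ← hv₂]
  -- Difference of squares: `h - l = -Z (v - e v₁)` and `h + l = 2 (v - e v₁) + 2 (c - 1/2) (β -
  -- 1/2) v₂`.
  have key : ∑ i, h i ^ 2 / y i - ∑ i, l i ^ 2 / y i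
      = -2 * ∑ i, (v - e • v₁) i * (Z *ᵥ (v - e • v₁)) i / y i
        + -(2 * ((c - 1 / 2) * (β - 1 / 2))) * ∑ i, v₁ i * (Z *ᵥ v₁) i / y i
        + (2 * ((c - 1 / 2) * (β - 1 / 2)) * e) * ∑ i, v₂ i ^ 2 / y i := by
    simp only [Finset.mul_sum, ← Finset.sum_add_distrib, ← Finset.sum_sub_distrib]
    refine Finset.sum_congr rfl fun i _ => ?_
    rw [hZve, ← hv₂, hh, hl]
    simp only [Pi.add_apply, Pi.sub_apply, Pi.smul_apply, smul_eq_mul, he]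
    ring
  have hcβ : 0 ≤ (c - 1 / 2) * (β - 1 / 2) := mul_nonneg (by linarith) (by linarith)
  have d0 := hZ.dissipative hy hZy (v - e • v₁)
  have d1 := hZ.dissipative hy hZy v₁
  have d2 : 0 ≤ ∑ i, v₂ i ^ 2 / y i :=
    Finset.sum_nonneg fun i _ => div_nonneg (sq_nonneg _) (hy i).le
  have t1 := mul_nonneg hcβ (neg_nonneg.mpr d1)
  have t2 := mul_nonneg (mul_nonneg hcβ (by linarith : 0 ≤ e)) d2
  rcases d0.lt_or_eq with d | d
  · linarith
  -- Equality forces `v₁ = e Z v₁`, so `v₁ = 0` by invertibility of `1 - e Z`; then `h = v` lies in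
  -- `ker Z`.
  · exfalso
    have h0 := hZ.mulVec_eq_zero_of_dissipation_eq_zero hy hZy d
    rw [hZve, sub_eq_zero] at h0
    have hv₁0 : v₁ = 0 := by
      have hg := hZ.smul (by linarith : 0 ≤ e)
      have h1 : v₁ - (e • Z) *ᵥ v₁ = 0 := by
        rw [smul_mulVec, ← hv₂, sub_eq_zero]
        exact h0
      rw [← hg.eq_inv_mulVec_iff, mulVec_zero] at h1
      exact h1
    have hhv : h = v := by
      rw [hh, hv₂, hv₁0]
      simp
    refine hne (hZ.eq_zero_of_mulVec_eq_zero hy hZy ?_ hinv)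
    rw [hhv, ← hv₁, hv₁0]

/-- The linearised step map of the scheme, `w'` being the derivative of the weight. -/
noncomputable def linStep (Z : Matrix (Fin N) (Fin N) ℝ) (α β w' : ℝ) :
    Matrix (Fin N) (Fin N) ℝ :=
  (1 - (1 - α * β) • Z)⁻¹ *
    ((1 - α) • 1 + α • (1 - β • Z)⁻¹ + w' • (Z * ((1 - β • Z)⁻¹ - 1)))

theorem linStep_mulVec (α β w' : ℝ) (h : Fin N → ℝ) :
    linStep Z α β w' *ᵥ h = (1 - (1 - α * β) • Z)⁻¹ *ᵥ
      ((1 - α) • h + α • ((1 - β • Z)⁻¹ *ᵥ h)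
        + w' • (Z *ᵥ ((1 - β • Z)⁻¹ *ᵥ h - h))) := by
  simp only [linStep, ← mulVec_mulVec, add_mulVec, smul_mulVec, sub_mulVec, one_mulVec]

/-- Writing `h = (1 - β Z) (1 - c Z) v` clears both denominators: `h` and its image become
polynomials in `Z` applied to `v`. The hypothesis `hw` says `w' β = -q`. -/
theorem IsGenerator.linStep_sum_sq_div_lt (hZ : IsGenerator Z) (hy : IsPositiveVec y)
    (hZy : Z *ᵥ y = 0) {α β w' : ℝ} (hc : 1 / 2 ≤ 1 - α * β) (hβ : 1 / 2 ≤ β)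
    (hw : w' * β = -(1 / 2 - α * β + α * β ^ 2)) {h : Fin N → ℝ}
    (hinv : ∀ n, IsLinearInvariant Z n → n ⬝ᵥ h = 0) (hne : h ≠ 0) :
    ∑ i, (linStep Z α β w' *ᵥ h) i ^ 2 / y i < ∑ i, h i ^ 2 / y i := by
  have hgβ := hZ.smul (by linarith : 0 ≤ β)
  have hgc := hZ.smul (by linarith : 0 ≤ 1 - α * β)
  set c := 1 - α * β with hcdef
  set k := (1 - β • Z)⁻¹ *ᵥ h with hk
  have hk' : k - β • (Z *ᵥ k) = h := by
    rw [← smul_mulVec]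
    exact hgβ.inv_mulVec_sub h
  set v := (1 - c • Z)⁻¹ *ᵥ k with hv
  have hv' : v - c • (Z *ᵥ v) = k := by
    rw [← smul_mulVec]
    exact hgc.inv_mulVec_sub k
  set v₁ := Z *ᵥ v with hv₁
  set v₂ := Z *ᵥ v₁ with hv₂
  have hZk : Z *ᵥ k = v₁ - c • v₂ := by rw [← hv', mulVec_sub, mulVec_smul]
  have hh : h = v - (c + β) • v₁ + (c * β) • v₂ := by
    rw [← hk', hZk, ← hv']
    module
  refine hZ.sum_sq_div_lt hy hZy hc hβ hv₁ hv₂ hh ?_ hinv hne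
  rw [linStep_mulVec, eq_comm, hgc.eq_inv_mulVec_iff, ← hk]
  have hkh : k - h = β • (v₁ - c • v₂) := by
    rw [← hk', hZk]
    abel
  rw [hkh, mulVec_smul, smul_mulVec, mulVec_sub, mulVec_sub, mulVec_sub, mulVec_smul, mulVec_smul,
    mulVec_smul, ← hv₁, ← hv₂, smul_smul, hw, hh, ← hv', hcdef]
  module

/-- The energy loss is continuous and quadratic, so its positive minimum on the compact unit sphere
of the invariant-free subspace is a uniform margin. -/
theorem IsGenerator.exists_linStep_le (hZ : IsGenerator Z) (hy : IsPositiveVec y)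
    (hZy : Z *ᵥ y = 0) {α β w' : ℝ} (hc : 1 / 2 ≤ 1 - α * β) (hβ : 1 / 2 ≤ β)
    (hw : w' * β = -(1 / 2 - α * β + α * β ^ 2)) :
    ∃ m > 0, ∀ h : Fin N → ℝ, (∀ n, IsLinearInvariant Z n → n ⬝ᵥ h = 0) →
      ∑ i, (linStep Z α β w' *ᵥ h) i ^ 2 / y i ≤ ∑ i, h i ^ 2 / y i - m * ‖h‖ ^ 2 := by
  set F : (Fin N → ℝ) → ℝ := fun h =>
    ∑ i, h i ^ 2 / y i - ∑ i, (linStep Z α β w' *ᵥ h) i ^ 2 / y i with hF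
  have hFc : Continuous F := by
    refine Continuous.sub ?_ ?_
    · fun_prop
    · refine continuous_finsetSum _ fun i _ => Continuous.div_const (Continuous.pow ?_ 2) _
      exact (continuous_apply i).comp (Continuous.matrix_mulVec continuous_const continuous_id)
  set S : Set (Fin N → ℝ) :=
    Metric.sphere 0 1 ∩ {h | ∀ n, IsLinearInvariant Z n → n ⬝ᵥ h = 0} with hS
  have hSc : IsCompact S := by
    refine (isCompact_sphere _ _).inter_right ?_
    simp only [Set.ofPred_forall]
    refine isClosed_iInter fun n => isClosed_iInter fun _ => isClosed_eq ?_ continuous_const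
    exact Continuous.dotProduct continuous_const continuous_id
  have hpos : ∀ h ∈ S, 0 < F h := fun h hh => by
    have hne : h ≠ 0 := by
      rintro rfl
      have := hh.1
      simp at this
    exact sub_pos.mpr (hZ.linStep_sum_sq_div_lt hy hZy hc hβ hw hh.2 hne)
  obtain ⟨m, hm, hmF⟩ : ∃ m > 0, ∀ h ∈ S, m ≤ F h := by
    rcases S.eq_empty_or_nonempty with hE | hE
    -- The sphere is empty when only `h = 0` annihilates all invariants; any margin then works.
    · exact ⟨1, one_pos, by simp [hE]⟩
    · obtain ⟨h₀, h₀S, hmin⟩ := hSc.exists_isMinOn hE hFc.continuousOn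
      exact ⟨F h₀, hpos _ h₀S, fun h hh => hmin hh⟩
  refine ⟨m, hm, fun h hinv => ?_⟩
  rcases eq_or_ne h 0 with rfl | hne
  · simp
  have hn : 0 < ‖h‖ := norm_pos_iff.mpr hne
  have hmem : ‖h‖⁻¹ • h ∈ S := by
    refine ⟨by simp [norm_smul, hn.ne'], fun n hn' => ?_⟩
    rw [dotProduct_smul, hinv n hn', smul_zero]
  have h1 := hmF _ hmem
  have h2 : F (‖h‖⁻¹ • h) = (‖h‖⁻¹) ^ 2 * F h := by
    simp only [hF, mulVec_smul, Pi.smul_apply, smul_eq_mul, mul_sub, Finset.mul_sum, mul_pow,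
      mul_div_assoc]
  rw [h2, inv_pow, inv_mul_eq_div, le_div_iff₀ (by positivity)] at h1
  have : F h = ∑ i, h i ^ 2 / y i - ∑ i, (linStep Z α β w' *ᵥ h) i ^ 2 / y i := rfl
  linarith

end Contraction

/-! ### The scheme as an explicit map on positive vectors -/

section Scheme

variable {N : ℕ}

theorem SSPMPRK2Admissible.half_le {α β : ℝ} (h : SSPMPRK2Admissible α β) : 1 / 2 ≤ β := by
  obtain ⟨h0, -, hβ, h1⟩ := h
  have h2 : 1 / (2 * β) ≤ 1 := by nlinarith [mul_nonneg h0 hβ.le]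
  rw [div_le_one (by positivity)] at h2
  linarith

theorem SSPMPRK2Admissible.half_le_one_sub {α β : ℝ} (h : SSPMPRK2Admissible α β)
    (hα : α ≤ 1 / (2 * β)) : 1 / 2 ≤ 1 - α * β := by
  have hβ := h.2.2.1
  rw [le_div_iff₀ (by positivity)] at hα
  linarith

/-- The Patankar weight: the factor multiplying `A i j * z j` in the final stage, where `a = y j`
and `b = y₁ j`. -/
noncomputable def patankarWeight (α β a b : ℝ) : ℝ :=
  (sspBeta20 α β * a + sspBeta21 β * b) /
    (a ^ (1 - sspExponent α β) * b ^ sspExponent α β)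

theorem patankarWeight_nonneg {α β : ℝ} (h : SSPMPRK2Admissible α β) {a b : ℝ}
    (ha : 0 < a) (hb : 0 < b) : 0 ≤ patankarWeight α β a b := by
  obtain ⟨-, -, hβ, h1⟩ := h
  have h20 : 0 ≤ sspBeta20 α β := by
    unfold sspBeta20
    linarith
  have h21 : 0 ≤ sspBeta21 β := by
    unfold sspBeta21
    positivity
  unfold patankarWeight
  positivity

/-- The weight depends only on the ratio `b / a`, which reduces its linearisation to one variable.
-/
theorem patankarWeight_eq {α β a b : ℝ} (ha : 0 < a) (hb : 0 < b) :
    patankarWeight α β a b = sspBeta20 α β * (b / a) ^ (-sspExponent α β)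
      + sspBeta21 β * (b / a) ^ (1 - sspExponent α β) := by
  unfold patankarWeight
  set s := sspExponent α β
  rw [Real.div_rpow hb.le ha.le, Real.div_rpow hb.le ha.le, Real.rpow_sub ha, Real.rpow_sub hb,
    Real.rpow_neg ha.le, Real.rpow_neg hb.le, Real.rpow_one, Real.rpow_one]
  have := (Real.rpow_pos_of_pos ha s).ne'
  have := (Real.rpow_pos_of_pos hb s).ne'
  field_simp

/-- The first stage of the scheme as a map. -/
noncomputable def stageVec (Z : Matrix (Fin N) (Fin N) ℝ) (β : ℝ) (y : Fin N → ℝ) : Fin N → ℝ :=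
  (1 - β • Z)⁻¹ *ᵥ y

/-- The weights of the final stage. -/
noncomputable def weightVec (Z : Matrix (Fin N) (Fin N) ℝ) (α β : ℝ) (y : Fin N → ℝ) :
    Fin N → ℝ :=
  fun i => patankarWeight α β (y i) (stageVec Z β y i)

/-- One step of the scheme as a map. -/
noncomputable def stepVec (Z : Matrix (Fin N) (Fin N) ℝ) (α β : ℝ) (y : Fin N → ℝ) : Fin N → ℝ :=
  (1 - Z * diagonal (weightVec Z α β y))⁻¹ *ᵥ ((1 - α) • y + α • stageVec Z β y)

/-- Destruction supplies the diagonal of `A`, because zero column sums give `A i i = -∑ j ≠ i, A j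
i`. -/
theorem sum_production_sub_sum_destruction {A : Matrix (Fin N) (Fin N) ℝ} (hA : IsGenerator A)
    (t : Fin N → ℝ) (i : Fin N) :
    (∑ j, (if i = j then 0 else A i j) * t j) - ∑ j, (if j = i then 0 else A j i) * t i
      = (A *ᵥ t) i := by
  have h := hA.col_sum i
  rw [← Finset.add_sum_erase _ _ (Finset.mem_univ i)] at h
  have e1 : ∑ j, (if i = j then 0 else A i j) * t j
      = ∑ j ∈ Finset.univ.erase i, A i j * t j := by
    rw [← Finset.add_sum_erase _ _ (Finset.mem_univ i)]
    simp only [if_true, zero_mul, zero_add]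
    exact Finset.sum_congr rfl fun j hj => by rw [if_neg (Finset.ne_of_mem_erase hj).symm]
  have e2 : ∑ j, (if j = i then 0 else A j i) * t i
      = ∑ j ∈ Finset.univ.erase i, A j i * t i := by
    rw [← Finset.add_sum_erase _ _ (Finset.mem_univ i)]
    simp only [if_true, zero_mul, zero_add]
    exact Finset.sum_congr rfl fun j hj => by rw [if_neg (Finset.ne_of_mem_erase hj)]
  rw [e1, e2, ← Finset.sum_mul, mulVec, dotProduct,
    ← Finset.add_sum_erase _ _ (Finset.mem_univ i)]
  linear_combination -t i * h

variable {A : Matrix (Fin N) (Fin N) ℝ} {α β dt : ℝ} {y y₁ z : Fin N → ℝ}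

theorem SSPMPRK2Stage_iff (hA : IsGenerator A) (hβ : 0 ≤ β) (hdt : 0 ≤ dt)
    (hy : IsPositiveVec y) :
    SSPMPRK2Stage (linProd A) (linDest A) β dt y y₁ ↔ y₁ = stageVec (dt • A) β y := by
  rw [stageVec, ((hA.smul hdt).smul hβ).eq_inv_mulVec_iff, funext_iff]
  refine forall_congr' fun i => ?_
  have e1 : ∑ j, linProd A y i j * (y₁ j / y j)
      = ∑ j, (if i = j then 0 else A i j) * y₁ j := by
    refine Finset.sum_congr rfl fun j _ => ?_
    have := (hy j).ne'
    unfold linProd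
    split_ifs
    · simp
    · field_simp
  have e2 : ∑ j, linDest A y i j * (y₁ i / y i)
      = ∑ j, (if j = i then 0 else A j i) * y₁ i := by
    refine Finset.sum_congr rfl fun j _ => ?_
    have := (hy i).ne'
    unfold linDest linProd
    split_ifs
    · simp
    · field_simp
  rw [e1, e2, sum_production_sub_sum_destruction hA]
  simp only [smul_mulVec, Pi.sub_apply, Pi.smul_apply, smul_eq_mul]
  rw [sub_eq_iff_eq_add, mul_assoc]

theorem SSPMPRK2Final_iff (hA : IsGenerator A) (hαβ : SSPMPRK2Admissible α β) (hdt : 0 ≤ dt)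
    (hy : IsPositiveVec y) (hy₁ : IsPositiveVec y₁) :
    SSPMPRK2Final (linProd A) (linDest A) α β dt y y₁ z ↔
      z = (1 - (dt • A) * diagonal (fun i => patankarWeight α β (y i) (y₁ i)))⁻¹ *ᵥ
        ((1 - α) • y + α • y₁) := by
  rw [((hA.smul hdt).mul_diagonal
    fun i => patankarWeight_nonneg hαβ (hy i) (hy₁ i)).eq_inv_mulVec_iff, funext_iff]
  refine forall_congr' fun i => ?_
  set t : Fin N → ℝ := fun j => patankarWeight α β (y j) (y₁ j) * z j with ht
  have e1 : ∑ j, (sspBeta20 α β * linProd A y i j + sspBeta21 β * linProd A y₁ i j) *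
        (z j / (y j ^ (1 - sspExponent α β) * y₁ j ^ sspExponent α β))
      = ∑ j, (if i = j then 0 else A i j) * t j := by
    refine Finset.sum_congr rfl fun j _ => ?_
    simp only [linProd, ht, patankarWeight]
    split_ifs
    · simp
    · ring
  have e2 : ∑ j, (sspBeta20 α β * linDest A y i j + sspBeta21 β * linDest A y₁ i j) *
        (z i / (y i ^ (1 - sspExponent α β) * y₁ i ^ sspExponent α β))
      = ∑ j, (if j = i then 0 else A j i) * t i := by
    refine Finset.sum_congr rfl fun j _ => ?_
    simp only [linDest, linProd, ht, patankarWeight]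
    split_ifs
    · simp
    · ring
  have e3 : diagonal (fun i => patankarWeight α β (y i) (y₁ i)) *ᵥ z = t := by
    funext j
    rw [mulVec_diagonal]
  rw [e1, e2, sum_production_sub_sum_destruction hA, ← mulVec_mulVec, e3]
  simp only [smul_mulVec, Pi.add_apply, Pi.sub_apply, Pi.smul_apply, smul_eq_mul]
  rw [sub_eq_iff_eq_add]

theorem stageVec_pos {Z : Matrix (Fin N) (Fin N) ℝ} (hZ : IsGenerator Z) (hβ : 0 ≤ β)
    (hy : IsPositiveVec y) : IsPositiveVec (stageVec Z β y) :=
  (hZ.smul hβ).inv_mulVec_pos hy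

theorem weightVec_nonneg {Z : Matrix (Fin N) (Fin N) ℝ} (hZ : IsGenerator Z)
    (hαβ : SSPMPRK2Admissible α β) (hy : IsPositiveVec y) (i : Fin N) :
    0 ≤ weightVec Z α β y i :=
  patankarWeight_nonneg hαβ (hy i) (stageVec_pos hZ hαβ.2.2.1.le hy i)

theorem SSPMPRK2Step_iff (hA : IsGenerator A) (hαβ : SSPMPRK2Admissible α β) (hdt : 0 ≤ dt)
    (hy : IsPositiveVec y) :
    SSPMPRK2Step (linProd A) (linDest A) α β dt y z ↔ z = stepVec (dt • A) α β y := by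
  have hβ := hαβ.2.2.1.le
  have hp := stageVec_pos (hA.smul hdt) hβ hy
  simp only [SSPMPRK2Step, SSPMPRK2Stage_iff hA hβ hdt hy, exists_eq_left,
    SSPMPRK2Final_iff hA hαβ hdt hy hp]
  rfl

theorem stepVec_pos {Z : Matrix (Fin N) (Fin N) ℝ} (hZ : IsGenerator Z)
    (hαβ : SSPMPRK2Admissible α β) (hy : IsPositiveVec y) :
    IsPositiveVec (stepVec Z α β y) := by
  refine (hZ.mul_diagonal (weightVec_nonneg hZ hαβ hy)).inv_mulVec_pos fun i => ?_
  have h1 := stageVec_pos hZ hαβ.2.2.1.le hy i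
  have h0 := hy i
  simp only [Pi.add_apply, Pi.smul_apply, smul_eq_mul]
  obtain ⟨hα, hα1, -, -⟩ := hαβ
  rcases hα.lt_or_eq with h | h
  · exact add_pos_of_nonneg_of_pos (mul_nonneg (by linarith) h0.le) (mul_pos h h1)
  · simpa [← h] using h0

/-- The fixed point form of a step. -/
theorem stepVec_sub {Z : Matrix (Fin N) (Fin N) ℝ} (hZ : IsGenerator Z)
    (hαβ : SSPMPRK2Admissible α β) (hy : IsPositiveVec y) :
    stepVec Z α β y - Z *ᵥ (weightVec Z α β y * stepVec Z α β y)
      = (1 - α) • y + α • stageVec Z β y := by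
  have h := (hZ.mul_diagonal (weightVec_nonneg hZ hαβ hy)).inv_mulVec_sub
    ((1 - α) • y + α • stageVec Z β y)
  rw [← mulVec_mulVec] at h
  rw [← h, stepVec]
  congr 2
  funext i
  rw [mulVec_diagonal]
  rfl

theorem IsLinearInvariant.dotProduct_mulVec {Z : Matrix (Fin N) (Fin N) ℝ} {n : Fin N → ℝ}
    (hn : IsLinearInvariant Z n) (v : Fin N → ℝ) : n ⬝ᵥ (Z *ᵥ v) = 0 := by
  rw [Matrix.dotProduct_mulVec, ← mulVec_transpose, hn, zero_dotProduct]

theorem IsLinearInvariant.dotProduct_stepVec {Z : Matrix (Fin N) (Fin N) ℝ}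
    (hZ : IsGenerator Z) (hαβ : SSPMPRK2Admissible α β) (hy : IsPositiveVec y) {n : Fin N → ℝ}
    (hn : IsLinearInvariant Z n) : n ⬝ᵥ stepVec Z α β y = n ⬝ᵥ y := by
  have h1 := congrArg (n ⬝ᵥ ·) (stepVec_sub hZ hαβ hy)
  have h2 := congrArg (n ⬝ᵥ ·) ((hZ.smul hαβ.2.2.1.le).inv_mulVec_sub y)
  simp only [dotProduct_sub, dotProduct_add, dotProduct_smul, hn.dotProduct_mulVec, smul_mulVec,
    smul_eq_mul, mul_zero, sub_zero] at h1 h2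
  rw [h1, stageVec, h2]
  ring

end Scheme

/-! ### Differentiability of the step at an equilibrium -/

section Linearisation

open Asymptotics

variable {N : ℕ} {Z : Matrix (Fin N) (Fin N) ℝ} {α β : ℝ} {y : Fin N → ℝ}

theorem mulVec_isBigO {X : Type*} (M : Matrix (Fin N) (Fin N) ℝ) (f : X → Fin N → ℝ)
    (l : Filter X) : (fun x => M *ᵥ f x) =O[l] f :=
  (LinearMap.toContinuousLinearMap (Matrix.mulVecLin M)).isBigO_comp f l

/-- The derivative at `b / a = 1` of the Patankar weight. -/
noncomputable def patankarSlope (α β : ℝ) : ℝ :=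
  sspBeta20 α β * -sspExponent α β + sspBeta21 β * (1 - sspExponent α β)

/-- This is where the exponent `s` enters: the slope is `β₂₁ - s c`, and `s` makes `β` times it
equal to `-q`, the quadratic numerator coefficient that gives second order. -/
theorem patankarSlope_mul (h : SSPMPRK2Admissible α β) :
    patankarSlope α β * β = -(1 / 2 - α * β + α * β ^ 2) := by
  obtain ⟨-, -, hβ, h1⟩ := h
  have hβ' := hβ.ne'
  have hc : 1 - α * β ≠ 0 := by
    have : 0 < 1 / (2 * β) := by positivity
    linarith
  have hs : sspExponent α β * (β * (1 - α * β)) = 1 - α * β + α * β ^ 2 :=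
    div_mul_cancel₀ _ (mul_ne_zero hβ' hc)
  have h21 : sspBeta21 β * β = 1 / 2 := by
    unfold sspBeta21
    field_simp
  unfold patankarSlope sspBeta20
  rw [← sspBeta21]
  linear_combination h21 - hs

theorem hasDerivAt_weight (α β : ℝ) :
    HasDerivAt (fun r : ℝ => sspBeta20 α β * r ^ (-sspExponent α β)
      + sspBeta21 β * r ^ (1 - sspExponent α β)) (patankarSlope α β) 1 := by
  have h1 := (Real.hasDerivAt_rpow_const (x := 1) (p := -sspExponent α β)
    (Or.inl one_ne_zero)).const_mul (sspBeta20 α β)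
  have h2 := (Real.hasDerivAt_rpow_const (x := 1) (p := 1 - sspExponent α β)
    (Or.inl one_ne_zero)).const_mul (sspBeta21 β)
  simp only [Real.one_rpow, mul_one] at h1 h2
  exact h1.add h2

theorem sspBeta20_add_sspBeta21 (α β : ℝ) : sspBeta20 α β + sspBeta21 β = 1 - α * β := by
  unfold sspBeta20 sspBeta21
  ring

theorem eventually_isPositiveVec_add (hy : IsPositiveVec y) :
    ∀ᶠ h : Fin N → ℝ in 𝓝 0, IsPositiveVec (y + h) := by
  refine eventually_all.mpr fun i => ?_
  have : Tendsto (fun h : Fin N → ℝ => (y + h) i) (𝓝 0) (𝓝 (y i)) := by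
    have : Continuous (fun h : Fin N → ℝ => (y + h) i) := by
      simp only [Pi.add_apply]
      fun_prop
    simpa using this.tendsto 0
  exact this.eventually (lt_mem_nhds (hy i))

theorem stageVec_add (hZ : IsGenerator Z) (hβ : 0 ≤ β) (hZy : Z *ᵥ y = 0) (h : Fin N → ℝ) :
    stageVec Z β (y + h) = y + (1 - β • Z)⁻¹ *ᵥ h := by
  have : y = (1 - β • Z)⁻¹ *ᵥ y := by
    rw [(hZ.smul hβ).eq_inv_mulVec_iff, smul_mulVec, hZy, smul_zero, sub_zero]
  rw [stageVec, mulVec_add, ← this]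

theorem tendsto_mulVec_apply_zero (M : Matrix (Fin N) (Fin N) ℝ) (i : Fin N) :
    Tendsto (fun h : Fin N → ℝ => (M *ᵥ h) i) (𝓝 0) (𝓝 0) := by
  have : Continuous (fun h : Fin N → ℝ => (M *ᵥ h) i) :=
    (continuous_apply i).comp (Continuous.matrix_mulVec continuous_const continuous_id)
  simpa using this.tendsto 0

theorem isBigO_apply_id (i : Fin N) :
    (fun h : Fin N → ℝ => h i) =O[𝓝 0] fun h => h :=
  isBigO_pi.mp (isBigO_refl (fun h : Fin N → ℝ => h) (𝓝 0)) i

/-- Chain rule for the ratio of stage value to old value, which tends to 1. The factor `y i` cancels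
the denominator of that ratio to first order. -/
theorem weightVec_sub_isLittleO (hZ : IsGenerator Z) (hαβ : SSPMPRK2Admissible α β)
    (hy : IsPositiveVec y) (hZy : Z *ᵥ y = 0) (i : Fin N) :
    (fun h : Fin N → ℝ => (weightVec Z α β (y + h) i - (1 - α * β)) * y i
      - patankarSlope α β * (((1 - β • Z)⁻¹ *ᵥ h) i - h i)) =o[𝓝 0] fun h => h := by
  have hβ := hαβ.2.2.1.le
  set K := (1 - β • Z)⁻¹ with hK
  set r : (Fin N → ℝ) → ℝ := fun h => (y i + (K *ᵥ h) i) / (y i + h i) with hr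
  have hyi := (hy i).ne'
  have hth : Tendsto (fun h : Fin N → ℝ => h i) (𝓝 0) (𝓝 0) :=
    (continuous_apply i).tendsto' 0 0 rfl
  have htK := tendsto_mulVec_apply_zero K i
  have hr1 : Tendsto r (𝓝 0) (𝓝 1) := by
    have := (htK.const_add (y i)).div (hth.const_add (y i)) (by simpa using hyi)
    rwa [add_zero, div_self hyi] at this
  have hpos := eventually_isPositiveVec_add hy
  have hr1eq : ∀ᶠ h : Fin N → ℝ in 𝓝 0,
      r h - 1 = (y i + h i)⁻¹ * ((K *ᵥ h) i - h i) := by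
    filter_upwards [hpos] with h hh
    have h1 : y i + h i ≠ 0 := (hh i).ne'
    simp only [hr]
    field_simp
    ring
  have hKO : (fun h : Fin N → ℝ => (K *ᵥ h) i - h i) =O[𝓝 0] fun h => h :=
    (isBigO_pi.mp (mulVec_isBigO K (fun h => h) (𝓝 0)) i).sub (isBigO_apply_id i)
  have hinv : Tendsto (fun h : Fin N → ℝ => (y i + h i)⁻¹) (𝓝 0) (𝓝 (y i)⁻¹) := by
    have := (hth.const_add (y i)).inv₀ (by simpa using hyi)
    simpa using this
  have hrO : (fun h => r h - 1) =O[𝓝 0] fun h => h := by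
    have := (hinv.isBigO_one ℝ).mul hKO.norm_right
    simp only [one_mul] at this
    exact (this.congr' (hr1eq.mono fun h hh => hh.symm) EventuallyEq.rfl).of_norm_right
  have hφ := ((hasDerivAt_iff_isLittleO.mp (hasDerivAt_weight α β)).comp_tendsto hr1).trans_isBigO
    hrO
  have h1 : (fun h : Fin N → ℝ => y i * (weightVec Z α β (y + h) i - (1 - α * β)
      - (r h - 1) * patankarSlope α β)) =o[𝓝 0] fun h => h := by
    refine (hφ.congr' ?_ EventuallyEq.rfl).const_mul_left (y i)
    filter_upwards [hpos] with h hh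
    have hs := stageVec_pos hZ hβ hh i
    simp only [Function.comp_apply, Real.one_rpow, mul_one, smul_eq_mul,
      sspBeta20_add_sspBeta21]
    rw [weightVec, patankarWeight_eq (hh i) hs, stageVec_add hZ hβ hZy]
    rfl
  -- Cost of replacing the denominator `y i + h i` by `y i`: a product of two first-order terms.
  have h2 : (fun h : Fin N → ℝ => (-patankarSlope α β * h i) * (r h - 1))
      =o[𝓝 0] fun h => h := by
    have ht : Tendsto (fun h : Fin N → ℝ => -patankarSlope α β * h i) (𝓝 0) (𝓝 0) := by
      simpa using hth.const_mul (-patankarSlope α β)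
    have := ((isLittleO_one_iff ℝ).mpr ht).mul_isBigO hrO.norm_right
    simp only [one_mul] at this
    exact this.of_norm_right
  refine (h1.add h2).congr' ?_ EventuallyEq.rfl
  filter_upwards [hpos, hr1eq] with h hh hrh
  have h1 : y i + h i ≠ 0 := (hh i).ne'
  have h3 : (y i + h i) * (r h - 1) = (K *ᵥ h) i - h i := by
    rw [hrh]
    field_simp
  linear_combination -patankarSlope α β * h3

/-- The step map is differentiable at a positive equilibrium, with derivative `linStep`. -/
theorem stepVec_sub_isLittleO (hZ : IsGenerator Z) (hαβ : SSPMPRK2Admissible α β)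
    (hy : IsPositiveVec y) (hZy : Z *ᵥ y = 0) (hc : 0 ≤ 1 - α * β) :
    (fun h : Fin N → ℝ => stepVec Z α β (y + h) - y
      - linStep Z α β (patankarSlope α β) *ᵥ h) =o[𝓝 0] fun h => h := by
  have hβ := hαβ.2.2.1.le
  set w' := patankarSlope α β
  set c := 1 - α * β with hcdef
  set K := (1 - β • Z)⁻¹ with hK
  set C := (1 - c • Z)⁻¹ with hC
  set ε : (Fin N → ℝ) → Fin N → ℝ := fun h i => weightVec Z α β (y + h) i - c with hε
  set ρ : (Fin N → ℝ) → Fin N → ℝ := fun h => ε h * y - w' • (K *ᵥ h - h) with hρ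
  set l : (Fin N → ℝ) → Fin N → ℝ := fun h => stepVec Z α β (y + h) - y with hl
  have hρo : ρ =o[𝓝 0] fun h => h :=
    isLittleO_pi.mpr fun i => weightVec_sub_isLittleO hZ hαβ hy hZy i
  have hε0 : ∀ i, Tendsto (fun h => ε h i) (𝓝 0) (𝓝 0) := by
    intro i
    have t1 : Tendsto (fun h => ρ h i) (𝓝 0) (𝓝 0) :=
      (isLittleO_pi.mp hρo i).trans_tendsto tendsto_id
    have t2 : Tendsto (fun h : Fin N → ℝ => w' * ((K *ᵥ h) i - h i)) (𝓝 0) (𝓝 0) := by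
      have hth : Tendsto (fun h : Fin N → ℝ => h i) (𝓝 0) (𝓝 0) :=
        (continuous_apply i).tendsto' 0 0 rfl
      simpa using ((tendsto_mulVec_apply_zero K i).sub hth).const_mul w'
    have t3 := (t1.add t2).mul_const (y i)⁻¹
    simp only [add_zero, zero_mul] at t3
    refine t3.congr fun h => ?_
    have := (hy i).ne'
    simp only [hρ, Pi.sub_apply, Pi.mul_apply, Pi.smul_apply, smul_eq_mul]
    field_simp
    ring
  -- The varying inverse is never differentiated. The implicit equation is solved with the frozen
  -- weight `c`; the error `ε * l` is small relative to the unknown increment `l`, since `ε → 0`.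
  have hεl : (fun h => C *ᵥ (Z *ᵥ (ε h * l h))) =o[𝓝 0] l := by
    refine ((mulVec_isBigO C _ _).trans (mulVec_isBigO Z _ _)).trans_isLittleO ?_
    refine isLittleO_pi.mpr fun i => ?_
    have hli : (fun h => l h i) =O[𝓝 0] l := isBigO_pi.mp (isBigO_refl l (𝓝 0)) i
    have := ((isLittleO_one_iff ℝ).mpr (hε0 i)).mul_isBigO hli.norm_right
    simp only [one_mul] at this
    exact this.of_norm_right
  have hmain : ∀ᶠ h : Fin N → ℝ in 𝓝 0, l h - C *ᵥ (Z *ᵥ (ε h * l h))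
      = linStep Z α β w' *ᵥ h + C *ᵥ (Z *ᵥ ρ h) := by
    filter_upwards [eventually_isPositiveVec_add hy] with h hh
    have h1 := stepVec_sub hZ hαβ hh
    have hst : stepVec Z α β (y + h) = y + l h := by simp [hl]
    have hw : weightVec Z α β (y + h) * (y + l h)
        = c • y + c • l h + w' • (K *ᵥ h - h) + ρ h + ε h * l h := by
      funext i
      simp only [hρ, hε, Pi.add_apply, Pi.mul_apply, Pi.sub_apply, Pi.smul_apply, smul_eq_mul]
      ring
    rw [stageVec_add hZ hβ hZy, hst, hw] at h1
    simp only [mulVec_add, mulVec_smul, hZy, smul_zero, zero_add] at h1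
    rw [linStep_mulVec, ← hC, ← hK, sub_eq_iff_eq_add, ← mulVec_add, ← mulVec_add, hC,
      (hZ.smul hc).eq_inv_mulVec_iff, smul_mulVec]
    have h2 : l h - c • (Z *ᵥ l h) = (y + l h - (c • Z *ᵥ l h + w' • Z *ᵥ (K *ᵥ h - h) + Z *ᵥ ρ h
        + Z *ᵥ (ε h * l h))) + (w' • Z *ᵥ (K *ᵥ h - h) + Z *ᵥ ρ h
        + Z *ᵥ (ε h * l h)) - y := by abel
    rw [h2, h1]
    module
  have hCρ : (fun h => C *ᵥ (Z *ᵥ ρ h)) =o[𝓝 0] fun h => h :=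
    ((mulVec_isBigO C _ _).trans (mulVec_isBigO Z _ _)).trans_isLittleO hρo
  -- Bootstrap: absorbing the `o(l)` term gives `l = O(h)`, which turns that term into `o(h)`.
  have hlO : l =O[𝓝 0] fun h => h := by
    refine hεl.right_isBigO_sub.trans ?_
    exact ((mulVec_isBigO (linStep Z α β w') (fun h => h) _).add hCρ.isBigO).congr'
      (hmain.mono fun h hh => hh.symm) EventuallyEq.rfl
  refine (hCρ.add (hεl.trans_isBigO hlO)).congr' ?_ EventuallyEq.rfl
  filter_upwards [hmain] with h hh
  rw [sub_eq_iff_eq_add] at hh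
  refine eq_sub_of_add_eq (Eq.trans ?_ hh.symm)
  abel

end Linearisation

/-! ### From linear contraction to local convergence -/

section Convergence

open Asymptotics

variable {N : ℕ} {Z : Matrix (Fin N) (Fin N) ℝ} {α β : ℝ} {y : Fin N → ℝ}

theorem exists_sum_abs_sq_div_le (y : Fin N → ℝ) :
    ∃ C > 0, ∀ h : Fin N → ℝ, ∑ i, |h i ^ 2 / y i| ≤ C * ‖h‖ ^ 2 := by
  have hC : 0 ≤ ∑ i, |(y i)⁻¹| := Finset.sum_nonneg fun i _ => abs_nonneg _
  refine ⟨1 + ∑ i, |(y i)⁻¹|, by linarith, fun h => ?_⟩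
  have : ∑ i, |h i ^ 2 / y i| ≤ (∑ i, |(y i)⁻¹|) * ‖h‖ ^ 2 := by
    rw [Finset.sum_mul]
    refine Finset.sum_le_sum fun i _ => ?_
    rw [div_eq_mul_inv, abs_mul, abs_pow, mul_comm]
    have := norm_le_pi_norm h i
    rw [Real.norm_eq_abs] at this
    gcongr
  nlinarith [sq_nonneg ‖h‖]

theorem exists_norm_sq_le_sum_sq_div (hy : IsPositiveVec y) :
    ∃ C > 0, ∀ h : Fin N → ℝ, ‖h‖ ^ 2 ≤ C * ∑ i, h i ^ 2 / y i := by
  have hC : 0 ≤ ∑ i, y i := Finset.sum_nonneg fun i _ => (hy i).le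
  refine ⟨1 + ∑ i, y i, by linarith, fun h => ?_⟩
  have h0 : ∀ i, 0 ≤ h i ^ 2 / y i := fun i => div_nonneg (sq_nonneg _) (hy i).le
  have hs : 0 ≤ ∑ i, h i ^ 2 / y i := Finset.sum_nonneg fun i _ => h0 i
  have hle : ‖h‖ ≤ Real.sqrt ((1 + ∑ i, y i) * ∑ i, h i ^ 2 / y i) := by
    refine (pi_norm_le_iff_of_nonneg (Real.sqrt_nonneg _)).mpr fun i => Real.abs_le_sqrt ?_
    have h1 : y i ≤ 1 + ∑ i, y i := by
      have := Finset.single_le_sum (fun j _ => (hy j).le) (Finset.mem_univ i)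
      linarith
    have h2 := Finset.single_le_sum (fun j _ => h0 j) (Finset.mem_univ i)
    calc h i ^ 2 = y i * (h i ^ 2 / y i) := (mul_div_cancel₀ _ (hy i).ne').symm
      _ ≤ _ := mul_le_mul h1 h2 (h0 i) (by linarith)
  calc ‖h‖ ^ 2 ≤ Real.sqrt ((1 + ∑ i, y i) * ∑ i, h i ^ 2 / y i) ^ 2 := by gcongr
    _ = _ := Real.sq_sqrt (mul_nonneg (by linarith) hs)

/-- Near a positive equilibrium the step map contracts the weighted energy on each affine space of
constant linear invariants. -/
theorem exists_stepVec_contract (hZ : IsGenerator Z) (hαβ : SSPMPRK2Admissible α β)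
    (hα : α ≤ 1 / (2 * β)) (hy : IsPositiveVec y) (hZy : Z *ᵥ y = 0) :
    ∃ θ, 0 ≤ θ ∧ θ < 1 ∧ ∀ᶠ h : Fin N → ℝ in 𝓝 0,
      (∀ n, IsLinearInvariant Z n → n ⬝ᵥ h = 0) →
      ∑ i, (stepVec Z α β (y + h) - y) i ^ 2 / y i ≤ θ * ∑ i, h i ^ 2 / y i := by
  have hc := hαβ.half_le_one_sub hα
  obtain ⟨m, hm, hle⟩ := hZ.exists_linStep_le hy hZy hc hαβ.half_le (patankarSlope_mul hαβ)
  obtain ⟨C, hC, hCle⟩ := exists_sum_abs_sq_div_le y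
  set L := linStep Z α β (patankarSlope α β)
  set l : (Fin N → ℝ) → Fin N → ℝ := fun h => stepVec Z α β (y + h) - y with hl
  have ho : (fun h => l h - L *ᵥ h) =o[𝓝 0] fun h => h :=
    stepVec_sub_isLittleO hZ hαβ hy hZy (by linarith)
  have hO : (fun h => l h + L *ᵥ h) =O[𝓝 0] fun h => h := by
    have h1 := mulVec_isBigO L (fun h => h) (𝓝 0)
    refine (ho.isBigO.add (h1.add h1)).congr_left fun h => ?_
    abel
  -- Each difference of squares factors as `(l - L h) (l + L h) = o(h) O(h)`.
  have hdiff : (fun h => ∑ i, l h i ^ 2 / y i - ∑ i, (L *ᵥ h) i ^ 2 / y i)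
      =o[𝓝 0] fun h => ‖h‖ ^ 2 := by
    have : (fun h => ∑ i, (y i)⁻¹ * ((l h - L *ᵥ h) i * (l h + L *ᵥ h) i))
        =o[𝓝 0] fun h => ‖h‖ ^ 2 := by
      refine IsLittleO.fun_sum fun i _ => IsLittleO.const_mul_left ?_ _
      have := (isLittleO_pi.mp ho i).norm_right.mul_isBigO (isBigO_pi.mp hO i).norm_right
      simpa only [sq] using this
    refine this.congr_left fun h => ?_
    rw [← Finset.sum_sub_distrib]
    refine Finset.sum_congr rfl fun i _ => ?_
    simp only [Pi.sub_apply, Pi.add_apply]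
    ring
  -- Half of the margin `m` pays for the nonlinear error; the other half, `m / 2 * ‖h‖ ^ 2`, is at
  -- least `m / (2 * C)` times the energy. The `max` keeps the rate nonnegative.
  refine ⟨max 0 (1 - m / (2 * C)), le_max_left _ _, max_lt one_pos ?_, ?_⟩
  · have : 0 < m / (2 * C) := by positivity
    linarith
  filter_upwards [hdiff.bound (by positivity : 0 < m / 2)] with h hb hinv
  have h1 := hle h hinv
  have h2 := hCle h
  have h3 : ∑ i, h i ^ 2 / y i ≤ C * ‖h‖ ^ 2 :=
    (Finset.sum_le_sum fun i _ => le_abs_self _).trans h2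
  have h4 : 0 ≤ ∑ i, h i ^ 2 / y i :=
    Finset.sum_nonneg fun i _ => div_nonneg (sq_nonneg _) (hy i).le
  rw [Real.norm_eq_abs, norm_pow, norm_norm] at hb
  have h5 := (le_abs_self _).trans hb
  have h6 : m / (2 * C) * ∑ i, h i ^ 2 / y i ≤ m / 2 * ‖h‖ ^ 2 := by
    calc m / (2 * C) * ∑ i, h i ^ 2 / y i ≤ m / (2 * C) * (C * ‖h‖ ^ 2) := by gcongr
      _ = m / 2 * ‖h‖ ^ 2 := by field_simp
  have h7 := mul_le_mul_of_nonneg_right (le_max_right 0 (1 - m / (2 * C))) h4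
  change ∑ i, l h i ^ 2 / y i ≤ _
  linarith

/-- Positive equilibria attract nearby orbits of the step map with the same linear invariants. -/
theorem exists_tendsto_iterate (hZ : IsGenerator Z) (hαβ : SSPMPRK2Admissible α β)
    (hα : α ≤ 1 / (2 * β)) (hy : IsPositiveVec y) (hZy : Z *ᵥ y = 0) :
    ∃ δ > 0, ∀ u : ℕ → Fin N → ℝ, (∀ n, IsPositiveVec (u n)) →
      (∀ n, u (n + 1) = stepVec Z α β (u n)) → SameInvariants Z (u 0) y → ‖u 0 - y‖ < δ →
      Tendsto u atTop (𝓝 y) := by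
  obtain ⟨θ, hθ0, hθ1, hev⟩ := exists_stepVec_contract hZ hαβ hα hy hZy
  obtain ⟨η, hη, hev⟩ := Metric.eventually_nhds_iff.mp hev
  obtain ⟨C, hC, hCle⟩ := exists_sum_abs_sq_div_le y
  obtain ⟨c, hc, hcle⟩ := exists_norm_sq_le_sum_sq_div hy
  -- This radius gives `c * E 0 < η ^ 2`; since the energy does not grow, `‖u n - y‖ ^ 2 ≤ c * E n`
  -- keeps the orbit inside the contraction neighbourhood.
  refine ⟨η / Real.sqrt (c * C), by positivity, fun u hpos hstep hinv hu0 => ?_⟩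
  set E : ℕ → ℝ := fun n => ∑ i, (u n - y) i ^ 2 / y i with hE
  have hsame : ∀ n, ∀ k, IsLinearInvariant Z k → k ⬝ᵥ (u n - y) = 0 := by
    intro n k hk
    rw [dotProduct_sub, sub_eq_zero]
    induction n with
    | zero => exact hinv k hk
    | succ n ih => rw [hstep, hk.dotProduct_stepVec hZ hαβ (hpos n), ih]
  have hE0 : c * E 0 < η ^ 2 := by
    have h1 : E 0 ≤ C * ‖u 0 - y‖ ^ 2 :=
      (Finset.sum_le_sum fun i _ => le_abs_self _).trans (hCle _)
    rw [lt_div_iff₀ (by positivity)] at hu0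
    have h2 : (‖u 0 - y‖ * Real.sqrt (c * C)) ^ 2 < η ^ 2 := by gcongr
    rw [mul_pow, Real.sq_sqrt (by positivity)] at h2
    nlinarith
  have hEnn : ∀ n, 0 ≤ E n := fun n =>
    Finset.sum_nonneg fun i _ => div_nonneg (sq_nonneg _) (hy i).le
  have hEn : ∀ n, E n ≤ θ ^ n * E 0 := by
    intro n
    induction n with
    | zero => simp
    | succ n ih =>
      have hle : θ ^ n * E 0 ≤ E 0 := mul_le_of_le_one_left (hEnn 0) (pow_le_one₀ hθ0 hθ1.le)
      have hnear : dist (u n - y) 0 < η := by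
        rw [dist_zero_right]
        have h1 := hcle (u n - y)
        have h2 : c * E n ≤ c * E 0 := by
          gcongr
          exact ih.trans hle
        exact lt_of_pow_lt_pow_left₀ 2 hη.le (by linarith [h1.trans h2])
      have h1 := hev hnear (hsame n)
      rw [add_sub_cancel, ← hstep] at h1
      calc E (n + 1) ≤ θ * E n := h1
        _ ≤ θ * (θ ^ n * E 0) := by gcongr
        _ = θ ^ (n + 1) * E 0 := by ring
  have hsq : Tendsto (fun n => ‖u n - y‖ ^ 2) atTop (𝓝 0) := by
    have ht : Tendsto (fun n => c * (θ ^ n * E 0)) atTop (𝓝 0) := by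
      simpa using ((tendsto_pow_atTop_nhds_zero_of_lt_one hθ0 hθ1).mul_const (E 0)).const_mul c
    refine squeeze_zero (fun n => sq_nonneg _) (fun n => (hcle (u n - y)).trans ?_) ht
    exact mul_le_mul_of_nonneg_left (hEn n) hc.le
  rw [tendsto_iff_norm_sub_tendsto_zero]
  have := hsq.sqrt
  simpa [Real.sqrt_sq (norm_nonneg _)] using this

end Convergence

/-! ### The main theorem -/

theorem mainTheorem3 {N : ℕ} (A : Matrix (Fin N) (Fin N) ℝ)
    (hMetzler : IsMetzler A) (hcons : IsConservative A)
    (y₀ ystar : Fin N → ℝ) (hy₀ : IsPositiveVec y₀)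
    (hsteady : IsSteadyStateOfIVP A y₀ ystar) (hpos : IsPositiveVec ystar)
    (α β : ℝ) (hαβ : SSPMPRK2Admissible α β)
    (hcase : (α < 1 / (2 * β) ∧ (α, β) ≠ (0, 1 / 2)) ∨
      ((α = 1 / (2 * β) ∨ (α, β) = (0, 1 / 2)) ∧ NonzeroEigenvaluesNegRe A)) :
    (∀ y : Fin N → ℝ, IsSteadyStateOfIVP A y₀ y → y = ystar) ∧
    ∀ dt : ℝ, 0 < dt → ∃ δ : ℝ, 0 < δ ∧
      ∀ x : Fin N → ℝ, IsPositiveVec x → SameInvariants A x ystar → ‖x - ystar‖ < δ →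
        (∃! u : ℕ → Fin N → ℝ, IsSSPMPRK2Iterates A α β dt x u) ∧
        ∀ u : ℕ → Fin N → ℝ, IsSSPMPRK2Iterates A α β dt x u →
          (∀ n, IsPositiveVec (u n)) ∧ Tendsto u atTop (𝓝 ystar) := by
  have hA := IsGenerator.of_isConservative hMetzler hcons
  have hα : α ≤ 1 / (2 * β) := by
    rcases hcase with h | ⟨h | h, -⟩
    · exact h.1.le
    · exact h.le
    · have hβ := hαβ.2.2.1
      rw [(Prod.mk.inj h).1]
      positivity
  refine ⟨fun y hy => ?_, fun dt hdt => ?_⟩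
  · refine sub_eq_zero.mp (hA.eq_zero_of_mulVec_eq_zero hpos hsteady.1 ?_ fun n hn => ?_)
    · rw [mulVec_sub, hy.1, hsteady.1, sub_zero]
    · rw [dotProduct_sub, hy.2 n hn, hsteady.2 n hn, sub_self]
  have hZ := hA.smul hdt.le
  obtain ⟨δ, hδ, hconv⟩ := exists_tendsto_iterate (y := ystar) hZ hαβ hα hpos
    (by rw [smul_mulVec, hsteady.1, smul_zero])
  refine ⟨δ, hδ, fun x hx hinv hxδ => ?_⟩
  -- The scheme's equations are equivalent to the step map only at positive vectors, so positivity
  -- is propagated along the iterates.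
  have hiter : ∀ u, IsSSPMPRK2Iterates A α β dt x u →
      (∀ n, IsPositiveVec (u n)) ∧ ∀ n, u (n + 1) = stepVec (dt • A) α β (u n) := by
    rintro u ⟨h0, hstep⟩
    have hp : ∀ n, IsPositiveVec (u n) := by
      intro n
      induction n with
      | zero => rwa [h0]
      | succ n ih =>
        rw [(SSPMPRK2Step_iff hA hαβ hdt.le ih).mp (hstep n)]
        exact stepVec_pos hZ hαβ ih
    exact ⟨hp, fun n => (SSPMPRK2Step_iff hA hαβ hdt.le (hp n)).mp (hstep n)⟩
  refine ⟨⟨fun n => (stepVec (dt • A) α β)^[n] x, ⟨rfl, fun n => ?_⟩, fun u hu => ?_⟩,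
    fun u hu => ⟨(hiter u hu).1, ?_⟩⟩
  · have hp : ∀ n, IsPositiveVec ((stepVec (dt • A) α β)^[n] x) := by
      intro n
      induction n with
      | zero => exact hx
      | succ n ih =>
        rw [Function.iterate_succ_apply']
        exact stepVec_pos hZ hαβ ih
    exact (SSPMPRK2Step_iff hA hαβ hdt.le (hp n)).mpr (Function.iterate_succ_apply' _ _ _)
  · funext n
    induction n with
    | zero => exact hu.1
    | succ n ih => rw [(hiter u hu).2 n, ih, Function.iterate_succ_apply']
  · refine hconv u (hiter u hu).1 (hiter u hu).2 (fun n hn => ?_) (by rwa [hu.1])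
    rw [hu.1]
    refine hinv n ?_
    -- Since `dt ≠ 0`, the invariants of `dt • A` are those of `A`.
    have : dt • (Aᵀ *ᵥ n) = 0 := by
      rw [← smul_mulVec, ← transpose_smul]
      exact hn
    exact (smul_eq_zero.mp this).resolve_left hdt.ne'
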